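/- Let $K$ be an infinite field and $R=K[x,y,z]$ with its standard grading. For a homogeneous ideal $I\subset R$, say that $R/I$ has socle degree $s$ if $[R/I]_s\neq 0$ and $[R/I]_d=0$ for all $d>s$. Let $L_1,\dots,L_5\in R$ be general linear forms, that is, the vector of their $15$ coefficients lies outside the zero set of a suitable nonzero polynomial over $K$ in $15$ variables (depending only on $K$). Let $k\ge 3$ be an integer, and assume that $K$ has characteristic $0$ or characteristic greater than $2k-2$. Put $I=(L_1^k,\dots,L_4^k)$ and $J=(L_1^k,\dots,L_4^k,L_5^k)$. Then $R/I$ and $R/J$ have the same socle degree, namely $2k-2$. -/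

import Mathlib

open MvPolynomial

noncomputable section

/-- The linear form `∑ j, c j • x j` with coefficient vector `c`. -/
def linearForm {K : Type*} [Field K] {n : ℕ} (c : Fin n → K) : MvPolynomial (Fin n) K :=
  ∑ j, C (c j) * X j

/-- The property `P` holds for `r` general linear forms in `n` variables over `K`: it holds for all
`r`-tuples of linear forms whose coefficients lie outside the zero set of some nonzero polynomial in
the `r * n` coefficients. Over an infinite field these are the properties that hold on a nonempty
(hence dense) Zariski-open subset of the affine space of `r`-tuples of linear forms. -/
def ForGeneralLinearForms (K : Type*) [Field K] (r n : ℕ)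
    (P : (Fin r → MvPolynomial (Fin n) K) → Prop) : Prop :=
  ∃ Φ : MvPolynomial (Fin r × Fin n) K, Φ ≠ 0 ∧
    ∀ c : Fin r × Fin n → K, eval c Φ ≠ 0 → P (fun i => linearForm (fun j => c (i, j)))

/-- The ideal `(L₁^k, …, L_r^k)`. -/
def powerIdeal {K : Type*} [Field K] {n r : ℕ} (L : Fin r → MvPolynomial (Fin n) K) (k : ℕ) :
    Ideal (MvPolynomial (Fin n) K) :=
  Ideal.span (Set.range fun i => L i ^ k)

/-- The component `[R/I]_d` of degree `d` of the quotient of the polynomial ring `R` by an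
ideal `I`: the image in `R/I` of the space of forms of degree `d`. -/
def quotientComponent {K : Type*} [Field K] {n : ℕ} (I : Ideal (MvPolynomial (Fin n) K)) (d : ℕ) :
    Submodule K (MvPolynomial (Fin n) K ⧸ I) :=
  (homogeneousSubmodule (Fin n) K d).map (Ideal.Quotient.mkₐ K I).toLinearMap

/-- `R/I` has socle degree `s`: the last nonzero component of `R/I` is the one of degree `s`. -/
def HasSocleDegree {K : Type*} [Field K] {n : ℕ} (I : Ideal (MvPolynomial (Fin n) K)) (s : ℕ) :
    Prop :=
  IsGreatest {d : ℕ | quotientComponent I d ≠ ⊥} s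

end

/-! Upper bound: four linear forms in general position can be rescaled to x, y, z, w with x + y = z
+ w = ℓ. By the strong Lefschetz property of K[x,y]/(x^k, y^k), a form of degree a in x, y is,
modulo (x^k, y^k), a sum of terms ℓ^(a-i) g with g primitive of degree i: ℓ^(2k-1-2i) g ∈ (x^k,
y^k). This is the content of `span_pair_pow_le`; the same holds for z, w with the same ℓ. When a + b
= 2k-1, a product of two such terms carries ℓ to the power 2k-1-i-j ≥ 2k-1-2 max(i,j), so it lies in
I. Hence I contains every form of degree 2k-1.

Lower bound: some conic c passes through the five coefficient points. Under the action by
differentiation, c^(k-1), of degree 2k-2, pairs to zero with J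
(`constantCoeff_diffOp_of_mem_powerIdeal`). As (2k-2)! is invertible, a nonzero form of that degree
cannot pair to zero with all forms of that degree, so J misses one. -/

/-! ### Binomial identities -/

/-- The convolution of two binomial sequences. -/
theorem sum_choose_mul_choose (r n : ℕ) :
    ∑ i ∈ Finset.range (n + 1), (r + i).choose r * (r + (n - i)).choose r =
      (2 * r + n + 1).choose n := by
  have h := congrArg (PowerSeries.coeff n)
    (pow_add (PowerSeries.mk 1 : PowerSeries ℤ) (r + 1) (r + 1))
  rw [show r + 1 + (r + 1) = (2 * r + 1) + 1 by ring, PowerSeries.mk_one_pow_eq_mk_choose_add,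
    PowerSeries.mk_one_pow_eq_mk_choose_add, PowerSeries.coeff_mul,
    Finset.Nat.sum_antidiagonal_eq_sum_range_succ
      (fun i j => PowerSeries.coeff i _ * PowerSeries.coeff j _)] at h
  simp only [PowerSeries.coeff_mk] at h
  rw [show 2 * r + n + 1 = n + (2 * r + 1) by ring, Nat.choose_symm_add,
    show n + (2 * r + 1) = 2 * r + 1 + n by ring]
  exact_mod_cast h.symm

/-- Up to sign, this is the coefficient of x^n left after setting y = -x in the primitive form; the
closed form shows when it is invertible. -/
theorem sum_choose_mul_factorial (r n : ℕ) :
    ∑ i ∈ Finset.range (n + 1), n.choose i * (r + i).factorial * (r + (n - i)).factorial =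
      n.factorial * r.factorial ^ 2 * (2 * r + n + 1).choose n := by
  rw [← sum_choose_mul_choose, Finset.mul_sum]
  refine Finset.sum_congr rfl fun i hi => ?_
  have hi : i ≤ n := Nat.lt_succ_iff.1 (Finset.mem_range.1 hi)
  have h1 := Nat.choose_mul_factorial_mul_factorial hi
  have h2 := Nat.add_choose_mul_factorial_mul_factorial r i
  have h3 := Nat.add_choose_mul_factorial_mul_factorial r (n - i)
  rw [← Nat.choose_symm_add] at h2 h3
  rw [← h1, ← h2, ← h3]
  ring

/-- The alternating binomial sum of the values of a polynomial of small degree vanishes. -/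
theorem sum_alternating_choose_mul_eval {P : Polynomial ℤ} {n : ℕ} (hP : P.natDegree < n) :
    ∑ i ∈ Finset.range (n + 1), (-1) ^ i * (n.choose i : ℤ) * P.eval (i : ℤ) = 0 := by
  have h := congrFun (Polynomial.fwdDiff_iter_eq_zero_of_degree_lt hP) 0
  rw [fwdDiff_iter_eq_sum_shift] at h
  have h' := congrArg (fun z => (-1) ^ n * z) h
  simp only [Pi.zero_apply, mul_zero, Finset.mul_sum] at h'
  rw [← h']
  refine Finset.sum_congr rfl fun i hi => ?_
  have hi : i ≤ n := Nat.lt_succ_iff.1 (Finset.mem_range.1 hi)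
  obtain ⟨j, rfl⟩ := Nat.exists_eq_add_of_le hi
  have hj : ((-1 : ℤ) ^ j) * (-1) ^ j = 1 := by rw [← mul_pow]; simp
  simp only [smul_eq_mul, add_tsub_cancel_left, zero_add, nsmul_eq_mul, mul_one, pow_add]
  linear_combination (-(-1) ^ i * ((i + j).choose i : ℤ) * P.eval (i : ℤ)) * hj

/-- The product of falling factorials is a polynomial in i of degree a + b < n, killed by the n-th
difference. -/
theorem sum_alternating_choose_mul_descFactorial {r n a b : ℕ} (hab : a + b < n) :
    ∑ i ∈ Finset.range (n + 1), (-1) ^ i * (n.choose i : ℤ) *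
      (((r + i).descFactorial a : ℤ) * ((r + (n - i)).descFactorial b : ℤ)) = 0 := by
  have hdeg : ((descPochhammer ℤ a).comp (Polynomial.X + Polynomial.C (r : ℤ)) *
      (descPochhammer ℤ b).comp (Polynomial.C ((r + n : ℕ) : ℤ) - Polynomial.X)).natDegree < n := by
    refine lt_of_le_of_lt (Polynomial.natDegree_mul_le.trans ?_) hab
    refine add_le_add (Polynomial.natDegree_comp_le.trans ?_) (Polynomial.natDegree_comp_le.trans ?_)
    · rw [descPochhammer_natDegree, Polynomial.natDegree_X_add_C, mul_one]
    · rw [descPochhammer_natDegree, ← neg_sub, Polynomial.natDegree_neg,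
        Polynomial.natDegree_X_sub_C, mul_one]
  rw [← sum_alternating_choose_mul_eval hdeg]
  refine Finset.sum_congr rfl fun i hi => ?_
  have hi : i ≤ n := Nat.lt_succ_iff.1 (Finset.mem_range.1 hi)
  rw [Polynomial.eval_mul, Polynomial.eval_comp, Polynomial.eval_comp,
    ← descPochhammer_eval_eq_descFactorial ℤ, ← descPochhammer_eval_eq_descFactorial ℤ]
  simp only [Polynomial.eval_add, Polynomial.eval_sub, Polynomial.eval_X, Polynomial.eval_C]
  push_cast [hi]
  congr 3
  · rw [add_comm]
  · ring_nf

/-- The coefficient of the monomial of `x`-degree `s` in `(x + y) ^ N * x ^ a * y ^ b`. -/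
theorem add_pow_mul_pow_mul_pow {R : Type*} [CommRing R] (x y : R) (N a b : ℕ) :
    (x + y) ^ N * (x ^ a * y ^ b) = ∑ s ∈ Finset.range (N + a + b + 1),
      (if a ≤ s then (N.choose (s - a) : R) else 0) * (x ^ s * y ^ (N + a + b - s)) := by
  have hsub : ∑ s ∈ Finset.Ico a (N + a + 1),
      (if a ≤ s then (N.choose (s - a) : R) else 0) * (x ^ s * y ^ (N + a + b - s)) =
      ∑ s ∈ Finset.range (N + a + b + 1),
      (if a ≤ s then (N.choose (s - a) : R) else 0) * (x ^ s * y ^ (N + a + b - s)) := by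
    refine Finset.sum_subset ?_ ?_
    · intro s hs
      simp only [Finset.mem_Ico, Finset.mem_range] at hs ⊢
      omega
    · intro s _ hs
      simp only [Finset.mem_Ico, not_and, not_lt] at hs
      split_ifs with h
      · rw [Nat.choose_eq_zero_of_lt (by have := hs h; omega)]
        simp
      · simp
  rw [← hsub, Finset.sum_Ico_eq_sum_range, show N + a + 1 - a = N + 1 by omega, add_pow,
    Finset.sum_mul]
  refine Finset.sum_congr rfl fun i hi => ?_
  have hi : i ≤ N := Nat.lt_succ_iff.1 (Finset.mem_range.1 hi)
  rw [if_pos (by omega), show a + i - a = i by omega,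
    show N + a + b - (a + i) = N - i + b by omega, pow_add, pow_add]
  ring

/-- The coefficients of a form of degree `n` in two variables `x`, `y` that multiplication by
`(x + y) ^ (2 * r + 1)` sends into the ideal `(x ^ (r + n + 1), y ^ (r + n + 1))`. -/
def primitiveCoeff (r n i : ℕ) : ℤ :=
  (-1) ^ i * (n.choose i : ℤ) * ((r + i).factorial * (r + (n - i)).factorial : ℕ)

/-- The sum is a middle coefficient of (x + y)^(2r+1) times the primitive form. The factorials in
`primitiveCoeff` clear the denominators of the binomial, leaving (2r+1)! times falling factorials of
total degree n - 1. -/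
theorem sum_primitiveCoeff_mul_choose {r n s : ℕ} (h1 : r < s) (h2 : s ≤ r + n) :
    ∑ i ∈ Finset.range (n + 1), primitiveCoeff r n i *
      (if n - i ≤ s then ((2 * r + 1).choose (s - (n - i)) : ℤ) else 0) = 0 := by
  obtain ⟨e, rfl⟩ := Nat.exists_eq_add_of_lt h1
  have key := sum_alternating_choose_mul_descFactorial (r := r) (n := n) (a := n - 1 - e) (b := e)
    (by omega)
  have key' := congrArg (fun z => ((2 * r + 1).factorial : ℤ) * z) key
  simp only [mul_zero, Finset.mul_sum] at key'
  refine Eq.trans (Finset.sum_congr rfl fun i hi => ?_) key'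
  have hi : i ≤ n := Nat.lt_succ_iff.1 (Finset.mem_range.1 hi)
  have hnat : ((r + i).factorial * (r + (n - i)).factorial) *
      (if n - i ≤ r + e + 1 then (2 * r + 1).choose (r + e + 1 - (n - i)) else 0) =
      (2 * r + 1).factorial *
        ((r + i).descFactorial (n - 1 - e) * (r + (n - i)).descFactorial e) := by
    split_ifs with h
    · by_cases h' : e ≤ r + (n - i)
      · have e1 := Nat.factorial_mul_descFactorial (n := r + i) (k := n - 1 - e) (by omega)
        have e2 := Nat.factorial_mul_descFactorial (n := r + (n - i)) (k := e) (by omega)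
        have e3 := Nat.choose_mul_factorial_mul_factorial
          (n := 2 * r + 1) (k := r + e + 1 - (n - i)) (by omega)
        rw [show 2 * r + 1 - (r + e + 1 - (n - i)) = r + (n - i) - e by omega] at e3
        rw [show r + i - (n - 1 - e) = r + e + 1 - (n - i) by omega] at e1
        rw [← e1, ← e2, ← e3]
        ring
      · rw [Nat.choose_eq_zero_of_lt (by omega),
          Nat.descFactorial_of_lt (n := r + (n - i)) (by omega)]
        simp
    · rw [Nat.descFactorial_of_lt (n := r + i) (by omega)]
      simp
  have hint := congrArg (Nat.cast : ℕ → ℤ) hnat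
  push_cast at hint
  rw [primitiveCoeff]
  push_cast
  linear_combination ((-1) ^ i * (n.choose i : ℤ)) * hint

/-! ### Lefschetz decomposition in two variables -/

section TwoVariables

variable {R : Type*} [CommRing R] (x y : R)

/-- The form with coefficients `primitiveCoeff r n`. -/
def primitiveForm (r n : ℕ) : R :=
  ∑ i ∈ Finset.range (n + 1), (primitiveCoeff r n i : R) * (x ^ (n - i) * y ^ i)

theorem add_pow_mul_primitiveForm_mem (r n : ℕ) :
    (x + y) ^ (2 * r + 1) * primitiveForm x y r n ∈
      Ideal.span {x ^ (r + n + 1), y ^ (r + n + 1)} := by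
  have h : (x + y) ^ (2 * r + 1) * primitiveForm x y r n =
      ∑ s ∈ Finset.range (2 * r + 1 + n + 1),
        ((∑ i ∈ Finset.range (n + 1), primitiveCoeff r n i *
          (if n - i ≤ s then ((2 * r + 1).choose (s - (n - i)) : ℤ) else 0) : ℤ) : R) *
          (x ^ s * y ^ (2 * r + 1 + n - s)) := by
    push_cast
    simp_rw [Finset.sum_mul]
    rw [Finset.sum_comm, primitiveForm, Finset.mul_sum]
    refine Finset.sum_congr rfl fun i hi => ?_
    have hi : i ≤ n := Nat.lt_succ_iff.1 (Finset.mem_range.1 hi)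
    rw [mul_left_comm, add_pow_mul_pow_mul_pow, Finset.mul_sum,
      show 2 * r + 1 + (n - i) + i = 2 * r + 1 + n by omega]
    refine Finset.sum_congr rfl fun s _ => ?_
    ring
  rw [h]
  refine Ideal.sum_mem _ fun s _ => ?_
  rcases lt_or_ge s (r + 1) with hs | hs
  · refine Ideal.mul_mem_left _ _ (Ideal.mul_mem_left _ _ ?_)
    exact Ideal.pow_mem_of_pow_mem _ (show y ^ (r + n + 1) ∈ _ from Ideal.subset_span (by simp)) (by omega)
  · rcases lt_or_ge s (r + n + 1) with hs' | hs'
    · rw [sum_primitiveCoeff_mul_choose (by omega) (by omega)]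
      simp
    · refine Ideal.mul_mem_left _ _ (Ideal.mul_mem_right _ _ ?_)
      exact Ideal.pow_mem_of_pow_mem _ (Ideal.subset_span (by simp)) hs'

/-- This is y ≡ -x modulo x + y, with the degree of the cofactor recorded for the later induction.
-/
theorem pow_mul_pow_sub_mem (a i : ℕ) :
    x ^ a * y ^ i - (-1) ^ i * x ^ (a + i) ∈
      Ideal.span {x + y} * Ideal.span {x, y} ^ (a + i - 1) := by
  induction i generalizing a with
  | zero => simp
  | succ i ih =>
    have h1 : x ^ a * y ^ (i + 1) - (-1) ^ (i + 1) * x ^ (a + (i + 1)) =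
        (x + y) * (x ^ a * y ^ i) - (x ^ (a + 1) * y ^ i - (-1) ^ i * x ^ (a + 1 + i)) := by
      ring
    rw [h1, show a + (i + 1) - 1 = a + i by omega]
    refine Ideal.sub_mem _ (Ideal.mul_mem_mul (Ideal.subset_span rfl) ?_) ?_
    · rw [pow_add]
      exact Ideal.mul_mem_mul (Ideal.pow_mem_pow (Ideal.subset_span (by simp)) _)
        (Ideal.pow_mem_pow (Ideal.subset_span (by simp)) _)
    · have := ih (a + 1)
      rwa [show a + 1 + i - 1 = a + i by omega] at this

theorem primitiveForm_sub_mem (r n : ℕ) :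
    primitiveForm x y r n -
      ((n.factorial * r.factorial ^ 2 * (2 * r + n + 1).choose n : ℕ) : R) * x ^ n ∈
      Ideal.span {x + y} * Ideal.span {x, y} ^ (n - 1) := by
  rw [← sum_choose_mul_factorial, primitiveForm, Nat.cast_sum, Finset.sum_mul,
    ← Finset.sum_sub_distrib]
  refine Ideal.sum_mem _ fun i hi => ?_
  have hi : i ≤ n := Nat.lt_succ_iff.1 (Finset.mem_range.1 hi)
  have h := pow_mul_pow_sub_mem x y (n - i) i
  rw [show n - i + i = n by omega] at h
  have hs : ((-1 : R) ^ i) * (-1) ^ i = 1 := by rw [← mul_pow]; simp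
  convert Ideal.mul_mem_left _ (primitiveCoeff r n i : R) h using 1
  rw [primitiveCoeff]
  push_cast
  linear_combination (((n.choose i : R) * ((r + i).factorial : R) *
    ((r + (n - i)).factorial : R)) * x ^ n) * hs

theorem isUnit_factorial_of_le {m n : ℕ} (h : IsUnit ((n.factorial : ℕ) : R)) (hmn : m ≤ n) :
    IsUnit ((m.factorial : ℕ) : R) :=
  isUnit_of_dvd_unit (Nat.cast_dvd_cast (Nat.factorial_dvd_factorial hmn)) h

theorem pow_mem_of_primitive_mem {k : ℕ} (hk : IsUnit (((2 * k - 2).factorial : ℕ) : R)) (n : ℕ)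
    (T : Ideal R) (hx : x ^ k ∈ T)
    (hM : n ≠ 0 → Ideal.span {x + y} * Ideal.span {x, y} ^ (n - 1) ≤ T)
    (hT : n < k → ∀ g : R,
      (x + y) ^ (2 * k - 1 - 2 * n) * g ∈ Ideal.span {x ^ k, y ^ k} → g ∈ T) :
    x ^ n ∈ T := by
  rcases lt_or_ge n k with hnk | hnk
  · obtain ⟨r, rfl⟩ := Nat.exists_eq_add_of_lt hnk
    have h1 : primitiveForm x y r n ∈ T := by
      have := add_pow_mul_primitiveForm_mem x y r n
      rw [show r + n + 1 = n + r + 1 by ring] at this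
      exact hT hnk _ (by rwa [show 2 * (n + r + 1) - 1 - 2 * n = 2 * r + 1 by omega])
    have h2 : ((n.factorial * r.factorial ^ 2 * (2 * r + n + 1).choose n : ℕ) : R) * x ^ n ∈ T := by
      rcases Nat.eq_zero_or_pos n with rfl | hn0
      · simpa [primitiveForm, primitiveCoeff, sq] using h1
      · have := Ideal.sub_mem _ h1 (hM hn0.ne' (primitiveForm_sub_mem x y r n))
        simpa using this
    refine (Ideal.unit_mul_mem_iff_mem T ?_).1 h2
    rw [Nat.mul_right_comm, ← Nat.descFactorial_eq_factorial_mul_choose]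
    push_cast
    refine IsUnit.mul ?_ ((isUnit_factorial_of_le hk (by omega)).pow 2)
    -- The bound 2r+n+1 ≤ 2k-2 = 2n+2r needs n ≥ 1; for n = 0 the falling factorial is 1.
    rcases Nat.eq_zero_or_pos n with rfl | hn0
    · simp
    · exact isUnit_of_dvd_unit (Nat.cast_dvd_cast ⟨_, ((mul_comm _ _).trans
        (Nat.factorial_mul_descFactorial (n := 2 * r + n + 1) (k := n) (by omega))).symm⟩)
        (isUnit_factorial_of_le hk (m := 2 * r + n + 1) (by omega))
  · exact T.pow_mem_of_pow_mem hx hnk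

theorem sup_pow_le {A B T : Ideal R} {n : ℕ} (h : ∀ a b, a + b = n → A ^ a * B ^ b ≤ T) :
    (A ⊔ B) ^ n ≤ T := by
  rw [← Ideal.add_eq_sup, add_pow, Ideal.sum_eq_sup, Finset.sup_le_iff]
  intro a ha
  exact Ideal.mul_le_left.trans (h a (n - a) (by have := Finset.mem_range.1 ha; omega))

/-- An ideal containing `x ^ k`, `y ^ k` and the multiples by powers of `x + y` of the primitive
elements contains all forms of the corresponding degree. -/
theorem span_pair_pow_le {k : ℕ} (hk : IsUnit (((2 * k - 2).factorial : ℕ) : R)) (n : ℕ)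
    (T : Ideal R) (hx : x ^ k ∈ T)
    (hT : ∀ i < k, i ≤ n → ∀ g : R,
      (x + y) ^ (2 * k - 1 - 2 * i) * g ∈ Ideal.span {x ^ k, y ^ k} → (x + y) ^ (n - i) * g ∈ T) :
    Ideal.span {x, y} ^ n ≤ T := by
  induction n generalizing T with
  | zero =>
    have h1 := pow_mem_of_primitive_mem x y hk 0 T hx (by simp)
      (fun h0 g hg => by simpa using hT 0 h0 le_rfl g hg)
    rw [(Ideal.eq_top_iff_one T).2 (by simpa using h1)]
    exact le_top
  | succ n ih =>
    have hM : Ideal.span {x + y} * Ideal.span {x, y} ^ n ≤ T := by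
      rw [Ideal.span_singleton_mul_le_iff]
      -- Induction is applied to the colon ideal T : (x + y), which lowers each exponent of x + y by
      -- one.
      refine fun z hz => ih (Submodule.comap (LinearMap.mulLeft R (x + y)) T)
        (by simpa using T.mul_mem_left _ hx) (fun i hi hin g hg => ?_) hz
      have := hT i hi (by omega) g hg
      simpa [show n + 1 - i = n - i + 1 by omega, pow_succ', mul_assoc] using this
    have hX : x ^ (n + 1) ∈ T := pow_mem_of_primitive_mem x y hk (n + 1) T hx (fun _ => hM)
      (fun h0 g hg => by simpa using hT (n + 1) h0 le_rfl g hg)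
    rw [Ideal.span_insert]
    refine sup_pow_le fun a b hab => ?_
    rw [Ideal.span_singleton_pow, Ideal.span_singleton_pow, Ideal.span_singleton_mul_span_singleton,
      Ideal.span_singleton_le_iff_mem]
    have h := pow_mul_pow_sub_mem x y a b
    rw [hab, Nat.add_sub_cancel] at h
    simpa using T.add_mem (hM h) (T.mul_mem_left ((-1) ^ b) hX)

/-- Every form of degree `2 * k - 1` lies in the ideal of the `k`-th powers of four linear forms
`x`, `y`, `z`, `w` with `x + y = z + w`. -/
theorem span_pair_pow_mul_span_pair_pow_le (z w : R) (hxyzw : x + y = z + w) {k a b : ℕ}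
    (hk : IsUnit (((2 * k - 2).factorial : ℕ) : R)) (hab : a + b = 2 * k - 1)
    (I : Ideal R) (hx : x ^ k ∈ I) (hy : y ^ k ∈ I) (hz : z ^ k ∈ I) (hw : w ^ k ∈ I) :
    Ideal.span {x, y} ^ a * Ideal.span {z, w} ^ b ≤ I := by
  have hxy : Ideal.span {x ^ k, y ^ k} ≤ I := Ideal.span_le.2 (by simp [Set.pair_subset_iff, hx, hy])
  have hzw : Ideal.span {z ^ k, w ^ k} ≤ I := Ideal.span_le.2 (by simp [Set.pair_subset_iff, hz, hw])
  rw [Ideal.mul_le]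
  intro u hu v hv
  suffices h : Ideal.span {x, y} ^ a ≤ Submodule.comap (LinearMap.mulLeft R v) I by
    have := h hu
    rwa [Submodule.mem_comap, LinearMap.mulLeft_apply, mul_comm] at this
  refine span_pair_pow_le x y hk a _ (I.mul_mem_left v hx) fun i hik hia g hg => ?_
  suffices h : Ideal.span {z, w} ^ b ≤
      Submodule.comap (LinearMap.mulLeft R ((x + y) ^ (a - i) * g)) I by
    have := h hv
    rwa [Submodule.mem_comap, LinearMap.mulLeft_apply, mul_comm] at this
  refine span_pair_pow_le z w hk b _ (I.mul_mem_left _ hz) fun j hjk hjb h hh => ?_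
  change (x + y) ^ (a - i) * g * ((z + w) ^ (b - j) * h) ∈ I
  rw [← hxyzw] at hh ⊢
  -- The primitive factor of larger degree needs the smaller power of x + y, so it is the one that
  -- absorbs the product.
  rcases le_total j i with hij | hij
  · have h1 : (x + y) ^ (a - i) * g * ((x + y) ^ (b - j) * h) =
        ((x + y) ^ (i - j) * h) * ((x + y) ^ (2 * k - 1 - 2 * i) * g) := by
      rw [show ((x + y) ^ (i - j) * h) * ((x + y) ^ (2 * k - 1 - 2 * i) * g) =
        ((x + y) ^ (i - j) * (x + y) ^ (2 * k - 1 - 2 * i)) * (g * h) by ring, ← pow_add,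
        show i - j + (2 * k - 1 - 2 * i) = a - i + (b - j) by omega, pow_add]
      ring
    rw [h1]
    exact I.mul_mem_left _ (hxy hg)
  · have h1 : (x + y) ^ (a - i) * g * ((x + y) ^ (b - j) * h) =
        ((x + y) ^ (j - i) * g) * ((x + y) ^ (2 * k - 1 - 2 * j) * h) := by
      rw [show ((x + y) ^ (j - i) * g) * ((x + y) ^ (2 * k - 1 - 2 * j) * h) =
        ((x + y) ^ (j - i) * (x + y) ^ (2 * k - 1 - 2 * j)) * (g * h) by ring, ← pow_add,
        show j - i + (2 * k - 1 - 2 * j) = a - i + (b - j) by omega, pow_add]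
      ring
    rw [h1]
    exact I.mul_mem_left _ (hzw hh)

end TwoVariables

/-! ### Differential operators, apolarity and conics -/

noncomputable section Apolarity

variable {K σ : Type*} [Field K]

/-- Supplies the commutative target that `aeval` needs in `diffOp`. A commutator of derivations is a
derivation, so it is enough that it vanishes on the variables. -/
theorem isMulCommutative_adjoin_pderiv :
    IsMulCommutative (Algebra.adjoin K (Set.range fun i : σ =>
      ((pderiv i : Derivation K (MvPolynomial σ K) (MvPolynomial σ K)) :
        Module.End K (MvPolynomial σ K)))) := by
  refine Algebra.isMulCommutative_adjoin K ?_
  rintro _ ⟨i, rfl⟩ _ ⟨j, rfl⟩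
  have h : ⁅(pderiv i : Derivation K (MvPolynomial σ K) (MvPolynomial σ K)),
      (pderiv j : Derivation K (MvPolynomial σ K) (MvPolynomial σ K))⁆ = 0 := by
    classical
    refine MvPolynomial.derivation_ext fun l => ?_
    rw [Derivation.commutator_apply]
    simp only [pderiv_X, Derivation.zero_apply, Pi.single_apply]
    split_ifs <;> simp
  refine LinearMap.ext fun f => ?_
  have := congrArg (fun D => D f) h
  exact sub_eq_zero.1 this

open scoped IsMulCommutative in
/-- The action of polynomials on polynomials as differential operators with constant
coefficients. -/
def diffOp : MvPolynomial σ K →ₐ[K] Module.End K (MvPolynomial σ K) :=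
  haveI := isMulCommutative_adjoin_pderiv (K := K) (σ := σ)
  (Subalgebra.val _).comp (aeval fun i => (⟨_, Algebra.subset_adjoin ⟨i, rfl⟩⟩ :
    Algebra.adjoin K (Set.range fun i : σ =>
      ((pderiv i : Derivation K (MvPolynomial σ K) (MvPolynomial σ K)) :
        Module.End K (MvPolynomial σ K)))))

@[simp] theorem diffOp_X (i : σ) (f : MvPolynomial σ K) : diffOp (X i) f = pderiv i f := by
  simp [diffOp]

theorem diffOp_mul (f g h : MvPolynomial σ K) : diffOp (f * g) h = diffOp f (diffOp g h) := by
  rw [map_mul, Module.End.mul_apply]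

theorem pow_dvd_derivation {R A : Type*} [CommRing R] [CommRing A] [Algebra R A]
    (D : Derivation R A A) {c f : A} {m : ℕ} (h : c ^ (m + 1) ∣ f) : c ^ m ∣ D f := by
  obtain ⟨g, rfl⟩ := h
  rw [Derivation.leibniz, Derivation.leibniz_pow]
  simp only [smul_eq_mul, nsmul_eq_mul, Nat.add_sub_cancel]
  exact dvd_add ((pow_dvd_pow c (Nat.le_succ m)).mul_right _)
    (((dvd_mul_right _ _).mul_left _).mul_left _)

/-- An operator of order `e` maps the ideal `(c ^ (e + j))` into `(c ^ j)`. -/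
theorem diffOp_monomial_dvd (c : MvPolynomial σ K) (u : σ →₀ ℕ) (a : K) (j : ℕ)
    {f : MvPolynomial σ K} (hf : c ^ (u.degree + j) ∣ f) : c ^ j ∣ diffOp (monomial u a) f := by
  induction u using Finsupp.induction_linear generalizing j f a with
  | zero =>
    rw [show monomial 0 a = algebraMap K (MvPolynomial σ K) a from rfl, AlgHom.commutes]
    simpa [smul_eq_C_mul] using hf.mul_left _
  | add u v hu hv =>
    rw [show monomial (u + v) a = monomial u a * monomial v (1 : K) by simp [monomial_mul],
      diffOp_mul]
    exact hu _ _ (hv _ _ (by rwa [map_add, add_comm u.degree, add_assoc] at hf))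
  | single i n =>
    rw [show monomial (Finsupp.single i n) a = C a * X i ^ n by
      simp [X_pow_eq_monomial, C_mul_monomial], diffOp_mul]
    have h : c ^ j ∣ diffOp (X i ^ n) f := by
      rw [Finsupp.degree_single] at hf
      induction n generalizing f with
      | zero => simpa using hf
      | succ n ih =>
        rw [pow_succ, diffOp_mul, diffOp_X]
        refine ih ?_
        exact pow_dvd_derivation _ (by rwa [show n + 1 + j = n + j + 1 by ring] at hf)
    rw [show C a = algebraMap K (MvPolynomial σ K) a from rfl, AlgHom.commutes]
    simpa [smul_eq_C_mul] using h.mul_left _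

theorem diffOp_monomial_isHomogeneous (u : σ →₀ ℕ) (a : K) {n : ℕ}
    {f : MvPolynomial σ K} (hf : f.IsHomogeneous n) :
    (diffOp (monomial u a) f).IsHomogeneous (n - u.degree) := by
  induction u using Finsupp.induction_linear generalizing n f a with
  | zero =>
    rw [show monomial 0 a = algebraMap K (MvPolynomial σ K) a from rfl, AlgHom.commutes]
    simpa using (homogeneousSubmodule σ K n).smul_mem a hf
  | add u v hu hv =>
    rw [show monomial (u + v) a = monomial u a * monomial v (1 : K) by simp [monomial_mul],
      diffOp_mul, map_add, add_comm u.degree, ← Nat.sub_sub]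
    exact hu _ (hv _ hf)
  | single i m =>
    rw [show monomial (Finsupp.single i m) a = C a * X i ^ m by
      simp [X_pow_eq_monomial, C_mul_monomial], diffOp_mul]
    have h : (diffOp (X i ^ m) f).IsHomogeneous (n - m) := by
      induction m generalizing f n with
      | zero => simpa using hf
      | succ m ih =>
        rw [pow_succ, diffOp_mul, diffOp_X, add_comm m, ← Nat.sub_sub]
        exact ih hf.pderiv
    rw [show C a = algebraMap K (MvPolynomial σ K) a from rfl, AlgHom.commutes]
    simpa using (homogeneousSubmodule σ K (n - m)).smul_mem a h

/-- A nonzero form of degree `n` is not annihilated by all operators of order `n`, if `n !` is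
invertible. -/
theorem eq_zero_of_diffOp_eq_zero [Fintype σ] {n : ℕ} (hn : (n.factorial : K) ≠ 0)
    {f : MvPolynomial σ K} (hf : f.IsHomogeneous n)
    (h : ∀ g : MvPolynomial σ K, g.IsHomogeneous n → constantCoeff (diffOp g f) = 0) : f = 0 := by
  induction n generalizing f with
  | zero =>
    have h1 := h 1 (isHomogeneous_one σ K)
    rw [map_one, Module.End.one_apply] at h1
    rw [← totalDegree_zero_iff_isHomogeneous, totalDegree_eq_zero_iff_eq_C] at hf
    rw [hf, show coeff 0 f = 0 from h1, C_0]
  | succ n ih =>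
    rw [Nat.factorial_succ, Nat.cast_mul] at hn
    have hd : ∀ i, pderiv i f = 0 := fun i =>
      ih (right_ne_zero_of_mul hn) hf.pderiv fun g hg => by
        rw [← diffOp_X, ← diffOp_mul]
        exact h _ (hg.mul (isHomogeneous_X K i))
    -- Euler's identity gives (n+1) f = 0.
    have he := hf.sum_X_mul_pderiv
    simp only [hd, mul_zero, Finset.sum_const_zero] at he
    rw [← Nat.cast_smul_eq_nsmul K] at he
    exact (smul_eq_zero.1 he.symm).resolve_left (left_ne_zero_of_mul hn)

section LinearForm

variable {n : ℕ} (a : Fin n → K)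

theorem diffOp_linearForm (f : MvPolynomial (Fin n) K) :
    diffOp (linearForm a) f = ∑ i, a i • pderiv i f := by
  simp only [linearForm, map_sum, LinearMap.sum_apply, diffOp_mul, diffOp_X]
  refine Finset.sum_congr rfl fun i _ => ?_
  rw [show C (a i) = algebraMap K (MvPolynomial (Fin n) K) (a i) from rfl, AlgHom.commutes]
  rfl

theorem diffOp_linearForm_pow_isHomogeneous {d : ℕ} {f : MvPolynomial (Fin n) K}
    (hf : f.IsHomogeneous d) (k : ℕ) :
    (diffOp (linearForm a ^ k) f).IsHomogeneous (d - k) := by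
  induction k with
  | zero => simpa using hf
  | succ k ih =>
    rw [pow_succ', diffOp_mul, diffOp_linearForm]
    exact IsHomogeneous.sum _ _ _ fun i _ =>
      (homogeneousSubmodule (Fin n) K _).smul_mem (a i) ih.pderiv

theorem eval_diffOp_linearForm_pow {d : ℕ} {f : MvPolynomial (Fin n) K}
    (hf : f.IsHomogeneous d) (k : ℕ) :
    eval a (diffOp (linearForm a ^ k) f) = (d.descFactorial k : K) * eval a f := by
  induction k with
  | zero => simp
  | succ k ih =>
    have he := congrArg (eval a) (diffOp_linearForm_pow_isHomogeneous a hf k).sum_X_mul_pderiv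
    rw [map_sum, nsmul_eq_mul, map_mul, map_natCast, ih] at he
    rw [pow_succ', diffOp_mul, diffOp_linearForm, map_sum, Nat.descFactorial_succ, Nat.cast_mul,
      mul_assoc, ← he]
    exact Finset.sum_congr rfl fun i _ => by simp [smul_eval]

/-- For d > k the result has positive degree, for d < k the falling factorial is 0, and for d = k
the result is k! times the value of f at a. -/
theorem constantCoeff_diffOp_linearForm_pow {d k : ℕ} {f : MvPolynomial (Fin n) K}
    (hf : f.IsHomogeneous d) (h : d = k → eval a f = 0) :
    constantCoeff (diffOp (linearForm a ^ k) f) = 0 := by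
  have hh := diffOp_linearForm_pow_isHomogeneous a hf k
  rcases lt_or_ge k d with hkd | hkd
  · exact hh.coeff_eq_zero (by simp; omega)
  · rw [Nat.sub_eq_zero_of_le hkd, ← totalDegree_zero_iff_isHomogeneous,
      totalDegree_eq_zero_iff_eq_C] at hh
    have he := eval_diffOp_linearForm_pow a hf k
    rw [hh, eval_C] at he
    rw [constantCoeff_eq, he]
    rcases hkd.eq_or_lt with hkd | hkd
    · rw [h hkd, mul_zero]
    · rw [Nat.descFactorial_of_lt hkd, Nat.cast_zero, zero_mul]

/-- The inverse system: if `c` is a quadric through the points `a i`, the powers of the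
corresponding linear forms annihilate `c ^ (k - 1)`. -/
theorem constantCoeff_diffOp_of_mem_powerIdeal {r k : ℕ} (hk : 1 ≤ k) {p : Fin r → Fin n → K}
    {c : MvPolynomial (Fin n) K} (hc : c.IsHomogeneous 2) (hp : ∀ i, eval (p i) c = 0)
    {g : MvPolynomial (Fin n) K} (hg : g ∈ powerIdeal (fun i => linearForm (p i)) k) :
    constantCoeff (diffOp g (c ^ (k - 1))) = 0 := by
  obtain ⟨b, rfl⟩ := (Ideal.mem_span_range_iff_exists_fun).1 hg
  rw [map_sum, LinearMap.sum_apply, map_sum]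
  refine Finset.sum_eq_zero fun i _ => ?_
  generalize b i = q
  rw [mul_comm, diffOp_mul]
  induction q using MvPolynomial.induction_on' with
  | monomial u s =>
    refine constantCoeff_diffOp_linearForm_pow _
      (diffOp_monomial_isHomogeneous u s (hc.pow (k - 1))) fun h => ?_
    -- Here `h` forces order k - 2, which leaves one factor c in c^(k-1).
    obtain ⟨q, hq⟩ := diffOp_monomial_dvd c u s 1 (f := c ^ (k - 1)) (pow_dvd_pow c (by omega))
    rw [hq, pow_one, map_mul, hp, zero_mul]
  | add q₁ q₂ h₁ h₂ => rw [map_add, LinearMap.add_apply, map_add, map_add, h₁, h₂, add_zero]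

end LinearForm

/-- Through any five points there is a conic. -/
theorem exists_conic (p : Fin 5 → Fin 3 → K) :
    ∃ c : MvPolynomial (Fin 3) K, c ≠ 0 ∧ c.IsHomogeneous 2 ∧ ∀ i, eval (p i) c = 0 := by
  let q : Fin 6 → MvPolynomial (Fin 3) K :=
    ![X 0 * X 0, X 1 * X 1, X 2 * X 2, X 0 * X 1, X 0 * X 2, X 1 * X 2]
  let φ : (Fin 6 → K) →ₗ[K] (Fin 5 → K) :=
    Matrix.toLin' (Matrix.of fun i j => eval (p i) (q j))
  -- Six coefficients against five linear conditions.
  obtain ⟨v, hv, hv0⟩ := (Submodule.ne_bot_iff _).1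
    (LinearMap.ker_ne_bot_of_finrank_lt (f := φ) (by simp))
  refine ⟨∑ j, C (v j) * q j, fun h => hv0 ?_, ?_, fun i => ?_⟩
  · have he : ∀ t : Fin 3 → K, eval t (∑ j, C (v j) * q j) = 0 := fun t => by rw [h, map_zero]
    have h0 := he ![1, 0, 0]
    have h1 := he ![0, 1, 0]
    have h2 := he ![0, 0, 1]
    have h3 := he ![1, 1, 0]
    have h4 := he ![1, 0, 1]
    have h5 := he ![0, 1, 1]
    simp [q, Fin.sum_univ_succ] at h0 h1 h2 h3 h4 h5
    simp only [h0, h1, h2, zero_add] at h3 h4 h5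
    ext j
    fin_cases j <;> assumption
  · refine IsHomogeneous.sum _ _ _ fun j _ => ?_
    refine IsHomogeneous.C_mul ?_ _
    fin_cases j <;> exact (isHomogeneous_X K _).mul (isHomogeneous_X K _)
  · have := congrFun (LinearMap.mem_ker.1 hv) i
    rw [map_sum]
    simpa [φ, Matrix.mulVec, dotProduct, mul_comm] using this

end Apolarity

/-! ### Four forms in general position and the socle degree -/

/-- The determinant of the matrix with rows `a`, `b`, `d`. -/
def tripleDet {R : Type*} [CommRing R] (a b d : Fin 3 → R) : R :=
  a 0 * (b 1 * d 2 - b 2 * d 1) - a 1 * (b 0 * d 2 - b 2 * d 0) + a 2 * (b 0 * d 1 - b 1 * d 0)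

theorem map_tripleDet {R S : Type*} [CommRing R] [CommRing S] (f : R →+* S) (a b d : Fin 3 → R) :
    f (tripleDet a b d) = tripleDet (f ∘ a) (f ∘ b) (f ∘ d) := by
  simp [tripleDet]

section

variable {K : Type*} [Field K]

/-- Cramer's rule. -/
theorem tripleDet_mul_linearForm (a b d u : Fin 3 → K) :
    C (tripleDet a b d) * linearForm u = C (tripleDet u b d) * linearForm a +
      C (tripleDet a u d) * linearForm b + C (tripleDet a b u) * linearForm d := by
  simp only [tripleDet, linearForm, Fin.sum_univ_three, map_add, map_sub, map_mul]
  ring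

theorem linearForm_single {n : ℕ} (j : Fin n) : linearForm (Pi.single j (1 : K)) = X j := by
  rw [linearForm, Finset.sum_eq_single j]
  · simp
  · intro i _ hij
    simp [hij]
  · simp

theorem idealOfVars_le {a b d : Fin 3 → K} (h : tripleDet a b d ≠ 0)
    {I : Ideal (MvPolynomial (Fin 3) K)} (ha : linearForm a ∈ I) (hb : linearForm b ∈ I)
    (hd : linearForm d ∈ I) : idealOfVars (Fin 3) K ≤ I := by
  rw [idealOfVars, Ideal.span_le]
  rintro _ ⟨j, rfl⟩
  have hu : IsUnit (C (tripleDet a b d) : MvPolynomial (Fin 3) K) := (IsUnit.mk0 _ h).map C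
  refine (Ideal.unit_mul_mem_iff_mem I hu).1 ?_
  rw [← linearForm_single, tripleDet_mul_linearForm]
  exact I.add_mem (I.add_mem (I.mul_mem_left _ ha) (I.mul_mem_left _ hb)) (I.mul_mem_left _ hd)

/-- The ideal of the `k`-th powers of four linear forms in linearly general position contains
all forms of degree `2 * k - 1`. -/
theorem idealOfVars_pow_le {k : ℕ} (hk : ((2 * k - 2).factorial : K) ≠ 0) {a b d u : Fin 3 → K}
    (habd : tripleDet a b d ≠ 0) (hubd : tripleDet u b d ≠ 0) (haud : tripleDet a u d ≠ 0)
    (habu : tripleDet a b u ≠ 0) {I : Ideal (MvPolynomial (Fin 3) K)}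
    (ha : linearForm a ^ k ∈ I) (hb : linearForm b ^ k ∈ I) (hd : linearForm d ^ k ∈ I)
    (hu : linearForm u ^ k ∈ I) : idealOfVars (Fin 3) K ^ (2 * k - 1) ≤ I := by
  have hC : ∀ {s : K}, s ≠ 0 → IsUnit (C s : MvPolynomial (Fin 3) K) :=
    fun h => (IsUnit.mk0 _ h).map C
  have hkR : IsUnit (((2 * k - 2).factorial : ℕ) : MvPolynomial (Fin 3) K) := by
    simpa using hC hk
  have hpow : ∀ (s : K) {l : MvPolynomial (Fin 3) K}, l ^ k ∈ I → (C s * l) ^ k ∈ I :=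
    fun s l hl => by
      rw [mul_pow]
      exact I.mul_mem_left _ hl
  -- Cramer's relation with the d-term moved to the other side, whence the minus sign in z.
  set x := C (tripleDet u b d) * linearForm a with hxdef
  set y := C (tripleDet a u d) * linearForm b with hydef
  set z := C (-tripleDet a b u) * linearForm d with hzdef
  set w := C (tripleDet a b d) * linearForm u with hwdef
  have hxyzw : x + y = z + w := by
    rw [hwdef, tripleDet_mul_linearForm, hzdef, C_neg]
    ring
  have hle : idealOfVars (Fin 3) K ≤ Ideal.span {x, y} ⊔ Ideal.span {z, w} := by
    refine idealOfVars_le habd ((Ideal.unit_mul_mem_iff_mem _ (hC hubd)).1 ?_)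
      ((Ideal.unit_mul_mem_iff_mem _ (hC haud)).1 ?_)
      ((Ideal.unit_mul_mem_iff_mem _ (hC (neg_ne_zero.2 habu))).1 ?_)
    · exact Ideal.mem_sup_left (Ideal.subset_span (by simp [hxdef]))
    · exact Ideal.mem_sup_left (Ideal.subset_span (by simp [hydef]))
    · exact Ideal.mem_sup_right (Ideal.subset_span (by simp [hzdef]))
  exact (Ideal.pow_right_mono hle _).trans (sup_pow_le fun i j hij =>
    span_pair_pow_mul_span_pair_pow_le x y z w hxyzw hkR hij I (hpow _ ha) (hpow _ hb) (hpow _ hd)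
      (hpow _ hu))

theorem quotientComponent_eq_bot_iff {n : ℕ} {I : Ideal (MvPolynomial (Fin n) K)} {d : ℕ} :
    quotientComponent I d = ⊥ ↔ ∀ f : MvPolynomial (Fin n) K, f.IsHomogeneous d → f ∈ I := by
  rw [quotientComponent, eq_bot_iff, Submodule.map_le_iff_le_comap, SetLike.le_def]
  simp [Ideal.Quotient.eq_zero_iff_mem]

theorem mem_idealOfVars_pow {σ : Type*} {d m : ℕ} {f : MvPolynomial σ K} (hf : f.IsHomogeneous d)
    (hmd : m ≤ d) : f ∈ idealOfVars σ K ^ m := by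
  rw [mem_pow_idealOfVars_iff']
  exact fun x hx => hf.coeff_eq_zero (by omega)

/-- Vanishing above 2k-2 passes up to larger ideals and nonvanishing passes down, so one bound of
each kind serves both ideals of the theorem. -/
theorem hasSocleDegree_of_le {n k : ℕ} {I J : Ideal (MvPolynomial (Fin n) K)} (hk : 1 ≤ k)
    (hI : idealOfVars (Fin n) K ^ (2 * k - 1) ≤ I) (hIJ : I ≤ J)
    (hJ : quotientComponent J (2 * k - 2) ≠ ⊥) : HasSocleDegree I (2 * k - 2) := by
  refine ⟨fun h => hJ ?_, fun d hd => ?_⟩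
  · rw [quotientComponent_eq_bot_iff] at h ⊢
    exact fun f hf => hIJ (h f hf)
  · by_contra! hlt
    exact hd (quotientComponent_eq_bot_iff.2 fun f hf =>
      hI (mem_idealOfVars_pow hf (by omega)))

/-- No general position is needed: the conic may be degenerate, as only c^(k-1) ≠ 0 matters. -/
theorem quotientComponent_powerIdeal_ne_bot {k : ℕ} (hk : 1 ≤ k)
    (hfac : ((2 * k - 2).factorial : K) ≠ 0) (p : Fin 5 → Fin 3 → K) :
    quotientComponent (powerIdeal (fun i => linearForm (p i)) k) (2 * k - 2) ≠ ⊥ := by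
  intro h
  rw [quotientComponent_eq_bot_iff] at h
  obtain ⟨c, hc0, hc, hp⟩ := exists_conic p
  have hhom : (c ^ (k - 1)).IsHomogeneous (2 * k - 2) := by
    have := hc.pow (k - 1)
    rwa [show 2 * (k - 1) = 2 * k - 2 by omega] at this
  exact pow_ne_zero (k - 1) hc0 (eq_zero_of_diffOp_eq_zero hfac hhom fun g hg =>
    constantCoeff_diffOp_of_mem_powerIdeal hk hc hp (h g hg))

theorem factorial_ne_zero_of_ringChar {n : ℕ} (h : ringChar K = 0 ∨ n < ringChar K) :
    (n.factorial : K) ≠ 0 := by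
  rw [Ne, ringChar.spec]
  rcases h with h | h
  · rw [h, zero_dvd_iff]
    exact n.factorial_ne_zero
  · have hp : (ringChar K).Prime :=
      (CharP.char_is_prime_or_zero K (ringChar K)).resolve_right (by omega)
    rw [hp.dvd_factorial]
    omega

end

theorem proposition6p1 (K : Type*) [Field K] [Infinite K] :
    ForGeneralLinearForms K 5 3 fun L =>
      ∀ k : ℕ, 3 ≤ k → (ringChar K = 0 ∨ 2 * k - 2 < ringChar K) →
        HasSocleDegree (powerIdeal (fun i : Fin 4 => L i.castSucc) k) (2 * k - 2) ∧
        HasSocleDegree (powerIdeal L k) (2 * k - 2) := by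
  let v : Fin 5 → Fin 3 → MvPolynomial (Fin 5 × Fin 3) K := fun i j => X (i, j)
  have hev : ∀ (c : Fin 5 × Fin 3 → K) (i j l : Fin 5), eval c (tripleDet (v i) (v j) (v l)) =
      tripleDet (fun m => c (i, m)) (fun m => c (j, m)) (fun m => c (l, m)) := by
    intro c i j l
    rw [map_tripleDet]
    congr 1 <;> ext m <;> simp [v]
  -- Genericity means that the four maximal minors of the first four forms are nonzero; the fifth
  -- form is free. The witness is the three coordinates, their sum, and zero.
  refine ⟨tripleDet (v 0) (v 1) (v 2) * tripleDet (v 3) (v 1) (v 2) *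
    tripleDet (v 0) (v 3) (v 2) * tripleDet (v 0) (v 1) (v 3), fun h => ?_, fun c hc k hk hchar => ?_⟩
  · have h1 := congrArg (eval fun q : Fin 5 × Fin 3 =>
      (![![1, 0, 0], ![0, 1, 0], ![0, 0, 1], ![1, 1, 1], ![0, 0, 0]] q.1 q.2 : K)) h
    simp only [map_mul, hev] at h1
    simp [tripleDet] at h1
  · simp only [map_mul, hev, mul_ne_zero_iff] at hc
    obtain ⟨⟨⟨h1, h2⟩, h3⟩, h4⟩ := hc
    have hfac := factorial_ne_zero_of_ringChar hchar
    set L : Fin 5 → MvPolynomial (Fin 3) K := fun i => linearForm fun j => c (i, j) with hL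
    have hI : idealOfVars (Fin 3) K ^ (2 * k - 1) ≤
        powerIdeal (fun i : Fin 4 => L i.castSucc) k :=
      idealOfVars_pow_le hfac h1 h2 h3 h4 (Ideal.subset_span ⟨0, rfl⟩) (Ideal.subset_span ⟨1, rfl⟩)
        (Ideal.subset_span ⟨2, rfl⟩) (Ideal.subset_span ⟨3, rfl⟩)
    have hIJ : powerIdeal (fun i : Fin 4 => L i.castSucc) k ≤ powerIdeal L k :=
      Ideal.span_mono (by rintro _ ⟨i, rfl⟩; exact ⟨i.castSucc, rfl⟩)
    have hJ := quotientComponent_powerIdeal_ne_bot (by omega) hfac fun i j => c (i, j)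
    exact ⟨hasSocleDegree_of_le (by omega) hI hIJ hJ,
      hasSocleDegree_of_le (by omega) (hI.trans hIJ) le_rfl hJ⟩
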